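/- An effect algebra is a set $E$ with two distinct elements $0,1$ and a partially defined binary operation $\oplus$ such that for all $a,b,c\in E$: (1) $b\oplus a=a\oplus b$ if $a\oplus b$ is defined; (2) $(a\oplus b)\oplus c=a\oplus(b\oplus c)$ if one side is defined; (3) there is a unique element $a'\in E$ with $a\oplus a'=1$; (4) if $1\oplus a$ is defined then $a=0$. It is partially ordered by $a\le b$ iff $a\oplus c=b$ for some $c\in E$; $0$ and $1$ are its least and greatest elements. $E$ is a complete lattice effect algebra if this order is a complete lattice. An atom is a minimal nonzero element, and $E$ is atomic if every nonzero element lies above an atom. Let $E$ be a complete atomic lattice effect algebra. * $E$ is almost orthogonal if for every atom $a$ the set of atoms $b$ with $b\not\le a'$ is finite. * The interval topology $\tau_i$ on $E$ is the topology having the intervals $[a,b]$, $a\le b$, as a closed subbasis. * A net $(x_\alpha)$ order converges to $x$, written $x_\alpha\xrightarrow{(o)}x$, if there are nets $(u_\alpha),(v_\alpha)$ over the same directed set with $u_\alpha\le x_\alpha\le v_\alpha$ for all $\alpha$, $(u_\alpha)$ increasing with $\bigvee_\alpha u_\alpha=x$, and $(v_\alpha)$ decreasing with $\bigwedge_\alpha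 v_\alpha=x$. The order topology $\tau_o$ is the finest topology on $E$ in which every order convergent net converges to its order limit. * Let $\mathcal U$ be the set of all finite joins $l_1a_1\vee\dots\vee l_na_n$ ($n\ge 1$), where the $a_i$ are atoms, $l_i\ge 1$, and the multiple $l_ia_i=a_i\oplus\dots\oplus a_i$ ($l_i$ times) exists; let $\mathcal V=\{x\in E: x'\in\mathcal U\}$. Let $\Phi$ consist of the indicator functions of the sets $\{x\in E:u\le x\}$, $u\in\mathcal U$, and $\{x\in E:x\le v\}$, $v\in\mathcal V$. Then $\tau_\Phi$ is the topology of the uniformity on $E$ induced by the pseudometrics $(x,y)\mapsto|\varphi(x)-\varphi(y)|$, $\varphi\in\Phi$. * $E$ is (o)-continuous if for every increasing net $(x_\alpha)$ in $E$ with supremum $x$ and every $y\in E$, the net $(x_\alpha\wedge y)$ has supremum $x\wedge y$. Then the following conditions are equivalent: 1. $E$ is almost orthogonal. 2. $\tau_i=\tau_o=\tau_\Phi$, and for every net $(x_\alpha)$ in $E$ and every $x\in E$, $x_\alpha$ converges to $x$ in $\tau_o$ if and only if $x_\alpha\xrightarrow{(o)}x$. 3. $E$ is (o)-continuous and $\tau_i$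 is Hausdorff. -/

import Mathlib

open Set Filter

universe u

/-- An effect algebra: a partial algebra `(E; ⊕, 0, 1)`. The value `oplus a b = none` means that
`a ⊕ b` is not defined, and `oplus a b = some c` means that it is defined and equal to `c`. -/
class EffectAlgebra (E : Type u) extends Zero E, One E where
  oplus : E → E → Option E
  zero_ne_one' : (0 : E) ≠ 1
  oplus_comm : ∀ a b : E, oplus a b = oplus b a
  /-- If one of the two sides is defined, then so is the other one, and they are equal. -/
  oplus_assoc : ∀ a b c : E,
    (oplus a b).bind (fun d => oplus d c) = (oplus b c).bind (fun d => oplus a d)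
  exists_unique_compl : ∀ a : E, ∃! b : E, oplus a b = some 1
  eq_zero_of_one_oplus : ∀ a c : E, oplus 1 a = some c → a = 0

namespace EffectAlgebra

/-- The order relation of `E` is the one that `⊕` defines: `a ≤ b` iff `a ⊕ c = b` for some `c`.
A lattice effect algebra is an effect algebra for which this order is a lattice order, that is,
`[EffectAlgebra E] [Lattice E] [InducedOrder E]`. -/
class InducedOrder (E : Type u) [EffectAlgebra E] [LE E] : Prop where
  le_iff : ∀ a b : E, a ≤ b ↔ ∃ c : E, oplus a c = some b

/-- The element `a'`, the unique one with `a ⊕ a' = 1`. -/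
noncomputable def compl {E : Type u} [EffectAlgebra E] (a : E) : E :=
  Classical.choose (exists_unique_compl a)

/-- The multiple `n a = a ⊕ a ⊕ ⋯ ⊕ a` (`n` times), `none` if it does not exist. -/
def nmul {E : Type u} [EffectAlgebra E] : ℕ → E → Option E
  | 0, _ => some 0
  | n + 1, a => (nmul n a).bind (fun b => oplus b a)

/-- For every atom `a` there are only finitely many atoms `b` with `b ≰ a'`. -/
def AlmostOrthogonal (E : Type u) [EffectAlgebra E] [PartialOrder E] [OrderBot E] : Prop :=
  ∀ a : E, IsAtom a → {b : E | IsAtom b ∧ ¬ b ≤ compl a}.Finite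

/-- The set `𝓤` of all finite joins `l₁a₁ ∨ ⋯ ∨ lₙaₙ`, `n ≥ 1`, where the `aᵢ` are atoms, `lᵢ ≥ 1`
and `lᵢaᵢ` exists (that is, `1 ≤ lᵢ ≤ ord aᵢ`). -/
def joinsOfMultiples (E : Type u) [EffectAlgebra E] [PartialOrder E] [OrderBot E] : Set E :=
  {x | ∃ (n : ℕ) (a : Fin n → E) (l : Fin n → ℕ) (b : Fin n → E), 1 ≤ n ∧
    (∀ i, IsAtom (a i) ∧ 1 ≤ l i ∧ nmul (l i) (a i) = some (b i)) ∧ IsLUB (range b) x}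

/-- The set `𝓥` of all `x` with `x' ∈ 𝓤`. -/
def meetsOfCoMultiples (E : Type u) [EffectAlgebra E] [PartialOrder E] [OrderBot E] : Set E :=
  {x | compl x ∈ joinsOfMultiples E}

/-- The function family `Φ`: the indicator functions `f_u` of `{x | u ≤ x}` for `u ∈ 𝓤` and `g_v`
of `{x | x ≤ v}` for `v ∈ 𝓥`. -/
noncomputable def functionFamily (E : Type u) [EffectAlgebra E] [PartialOrder E] [OrderBot E] :
    Set (E → ℝ) :=
  {φ | ∃ w ∈ joinsOfMultiples E, φ = indicator (Ici w) 1} ∪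
    {φ | ∃ w ∈ meetsOfCoMultiples E, φ = indicator (Iic w) 1}

/-- The uniformity on `E` induced by the family `Φ`, that is, by the pseudometrics
`(x, y) ↦ |φ x - φ y|`, `φ ∈ Φ`. -/
noncomputable abbrev familyUniformity (E : Type u) [EffectAlgebra E] [PartialOrder E] [OrderBot E] :
    UniformSpace E :=
  ⨅ φ ∈ functionFamily E, UniformSpace.comap φ (inferInstance : UniformSpace ℝ)

/-- The topology `τ_Φ` of that uniformity. -/
noncomputable abbrev familyTopology (E : Type u) [EffectAlgebra E] [PartialOrder E] [OrderBot E] :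
    TopologicalSpace E :=
  (familyUniformity E).toTopologicalSpace

end EffectAlgebra

/-- The interval topology `τ_i`: the closed intervals `[a, b]`, `a ≤ b`, form a closed subbasis. -/
abbrev intervalTopology (L : Type u) [PartialOrder L] : TopologicalSpace L :=
  TopologicalSpace.generateFrom {U | ∃ a b : L, a ≤ b ∧ U = (Icc a b)ᶜ}

/-- Order convergence of a net `(x_α)` to `a`: there are nets `(v_α)`, `(w_α)` over the same
directed set with `v_α ≤ x_α ≤ w_α`, `v_α ↑ a` and `w_α ↓ a`. -/
def OConverges {L : Type u} [PartialOrder L] {ι : Type u} [Preorder ι] (x : ι → L) (a : L) : Prop :=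
  ∃ v w : ι → L, (∀ i, v i ≤ x i ∧ x i ≤ w i) ∧
    Monotone v ∧ IsLUB (range v) a ∧ Antitone w ∧ IsGLB (range w) a

/-- Every order convergent net converges to the same limit in the topology `t`. -/
def OConvergenceImplies (L : Type u) [PartialOrder L] (t : TopologicalSpace L) : Prop :=
  ∀ (ι : Type u) [Preorder ι] [IsDirected ι (· ≤ ·)] [Nonempty ι] (x : ι → L) (a : L),
    OConverges x a → Tendsto x atTop (@nhds L t a)

/-- The order topology `τ_o`: the finest topology in which every order convergent net converges
to its order limit (`t ≤ s` means for topologies that `t` is finer than `s`). -/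
abbrev oTopology (L : Type u) [PartialOrder L] : TopologicalSpace L :=
  sInf {t | OConvergenceImplies L t}

theorem isLeast_oTopology (L : Type u) [PartialOrder L] :
    IsLeast {t | OConvergenceImplies L t} (oTopology L) := by
  refine ⟨?_, fun t ht => sInf_le ht⟩
  intro ι _ _ _ x a h
  change Tendsto x atTop (@nhds L (sInf {t | OConvergenceImplies L t}) a)
  rw [nhds_sInf]
  exact tendsto_iInf.2 fun t => tendsto_iInf.2 fun ht => ht ι x a h

/-- `t ≡ (o)`: convergence of nets in the topology `t` coincides with order convergence. -/
def TopologicalOConvergence (L : Type u) [PartialOrder L] (t : TopologicalSpace L) : Prop :=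
  ∀ (ι : Type u) [Preorder ι] [IsDirected ι (· ≤ ·)] [Nonempty ι] (x : ι → L) (a : L),
    Tendsto x atTop (@nhds L t a) ↔ OConverges x a

/-- (o)-continuity of a lattice: `x_α ↑ a` implies `x_α ∧ y ↑ a ∧ y`, for all nets and all `y`. -/
def OContinuous (L : Type u) [Lattice L] : Prop :=
  ∀ (ι : Type u) [Preorder ι] [IsDirected ι (· ≤ ·)] [Nonempty ι] (x : ι → L) (a y : L),
    Monotone x → IsLUB (range x) a → IsLUB (range fun i => x i ⊓ y) (a ⊓ y)

/-! Multiples of atoms are join-dense (`exists_mem_atomMultiples`), so they and their complements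
test every inequality. Convergence in `τ_Φ` makes each such test eventually constant, which forces
liminf and limsup to agree with the limit. Hence `τ_Φ` is always finer than `τ_o`, which is finer
than `τ_i`.

1 → 2: almost orthogonality leaves only finitely many multiples `w ≰ m'` for a multiple `m`. Since
`m ≤ y` fails exactly when some such `w` lies below `y'`, the set `{y | m ≤ y}` is clopen in `τ_i`,
and the three topologies collapse.

2 → 3: clopen tests separate points and pass through meets.

3 → 1: an infinite set of atoms not orthogonal to `a` carries a free ultrafilter. Hausdorffness of
`τ_i` makes its limsup `⊥`, and (o)-continuity then puts `a` below the complement of the join of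
some member, a contradiction. -/

namespace EffectAlgebra

open Topology

/-! ### Partial addition: associativity, cancellation, multiples -/

section Basic

variable {E : Type u} [EffectAlgebra E]

theorem oplus_compl (a : E) : oplus a (compl a) = some 1 :=
  (Classical.choose_spec (exists_unique_compl a)).1

theorem eq_compl_of_oplus {a b : E} (h : oplus a b = some 1) : b = compl a :=
  (Classical.choose_spec (exists_unique_compl a)).2 b h

theorem compl_compl (a : E) : compl (compl a) = a :=
  (eq_compl_of_oplus (by rw [oplus_comm, oplus_compl])).symm

theorem oplus_assoc_left {a b c d e : E} (h : oplus a b = some d) (h' : oplus d c = some e) :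
    ∃ f, oplus b c = some f ∧ oplus a f = some e := by
  have := oplus_assoc a b c
  rw [h, Option.bind_some, h'] at this
  exact Option.bind_eq_some_iff.1 this.symm

theorem oplus_assoc_right {a b c e f : E} (h : oplus b c = some f) (h' : oplus a f = some e) :
    ∃ d, oplus a b = some d ∧ oplus d c = some e := by
  have := oplus_assoc a b c
  rw [h, Option.bind_some, h'] at this
  exact Option.bind_eq_some_iff.1 this

theorem oplus_zero (a : E) : oplus a 0 = some a := by
  have h1 : oplus (1 : E) 0 = some 1 := by
    have h := oplus_compl (1 : E)
    rwa [eq_zero_of_one_oplus _ _ h] at h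
  have h2 : oplus (compl a) a = some 1 := by rw [oplus_comm, oplus_compl]
  obtain ⟨f, hf, hf'⟩ := oplus_assoc_left h2 h1
  rw [hf, eq_compl_of_oplus hf', compl_compl]

theorem zero_oplus (a : E) : oplus 0 a = some a := by rw [oplus_comm, oplus_zero]

theorem oplus_left_cancel {a b c d : E} (h : oplus a b = some c) (h' : oplus a d = some c) :
    b = d := by
  rw [oplus_comm] at h h'
  obtain ⟨f, hf, hbf⟩ := oplus_assoc_left h (oplus_compl c)
  obtain ⟨g, hg, hdg⟩ := oplus_assoc_left h' (oplus_compl c)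
  obtain rfl : f = g := Option.some.inj (hf.symm.trans hg)
  rw [oplus_comm] at hbf hdg
  rw [eq_compl_of_oplus hbf, eq_compl_of_oplus hdg]

theorem nmul_one (a : E) : nmul 1 a = some a := by simp [nmul, zero_oplus]

theorem nmul_succ {n : ℕ} {a b : E} (h : nmul n a = some b) : nmul (n + 1) a = oplus b a := by
  simp [nmul, h]

theorem exists_of_nmul_succ {n : ℕ} {a c : E} (h : nmul (n + 1) a = some c) :
    ∃ b, nmul n a = some b ∧ oplus b a = some c :=
  Option.bind_eq_some_iff.1 h

theorem nmul_eq_none_of_le {n m : ℕ} {a : E} (h : nmul n a = none) (hnm : n ≤ m) :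
    nmul m a = none := by
  induction hnm with
  | refl => exact h
  | step _ ih => simp [nmul, ih]

end Basic

section Order

variable {E : Type u} [EffectAlgebra E]

/-! ### Order and orthocomplement -/

section PartialOrder

variable [PartialOrder E] [InducedOrder E]

theorem le_of_oplus {a b c : E} (h : oplus a b = some c) : a ≤ c :=
  (InducedOrder.le_iff a c).2 ⟨b, h⟩

theorem le_of_oplus' {a b c : E} (h : oplus a b = some c) : b ≤ c :=
  le_of_oplus (by rwa [oplus_comm] at h)

theorem le_compl_iff {a b : E} : b ≤ compl a ↔ ∃ c, oplus a b = some c := by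
  constructor
  · intro h
    obtain ⟨c, hc⟩ := (InducedOrder.le_iff _ _).1 h
    obtain ⟨d, hd, -⟩ := oplus_assoc_right hc (oplus_compl a)
    exact ⟨d, hd⟩
  · rintro ⟨c, hc⟩
    obtain ⟨f, hf, hf'⟩ := oplus_assoc_left hc (oplus_compl c)
    rw [← eq_compl_of_oplus hf']
    exact le_of_oplus hf

theorem le_compl_comm {a b : E} : b ≤ compl a ↔ a ≤ compl b := by
  rw [le_compl_iff, le_compl_iff, oplus_comm]

theorem compl_le_compl {a b : E} (h : a ≤ b) : compl b ≤ compl a := by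
  rw [le_compl_comm, compl_compl]; exact h

theorem compl_le_compl_iff {a b : E} : compl b ≤ compl a ↔ a ≤ b :=
  ⟨fun h => by simpa only [compl_compl] using compl_le_compl h, compl_le_compl⟩

theorem oplus_le_oplus_iff {a b c d e : E} (hb : oplus a b = some d) (hc : oplus a c = some e) :
    d ≤ e ↔ b ≤ c := by
  constructor
  · intro h
    obtain ⟨f, hf⟩ := (InducedOrder.le_iff _ _).1 h
    obtain ⟨g, hg, hg'⟩ := oplus_assoc_left hb hf
    rw [oplus_left_cancel hc hg']
    exact le_of_oplus hg
  · intro h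
    obtain ⟨f, hf⟩ := (InducedOrder.le_iff _ _).1 h
    obtain ⟨g, hg, hg'⟩ := oplus_assoc_right hf hc
    obtain rfl : d = g := Option.some.inj (hb.symm.trans hg)
    exact le_of_oplus hg'

theorem zero_eq_bot [OrderBot E] : (0 : E) = ⊥ :=
  le_bot_iff.1 (le_of_oplus (zero_oplus ⊥))

theorem one_eq_top [OrderTop E] : (1 : E) = ⊤ := by
  refine top_le_iff.1 (le_of_oplus (oplus_compl ⊤))

theorem compl_bot [BoundedOrder E] : compl (⊥ : E) = ⊤ := by
  rw [← one_eq_top, ← zero_eq_bot]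
  exact (eq_compl_of_oplus (zero_oplus 1)).symm

end PartialOrder

/-! ### Orthogonality of multiples of atoms -/

section Lattice

variable [Lattice E] [BoundedOrder E] [InducedOrder E]

/-- An orthogonal sum of disjoint elements is their join. -/
theorem oplus_eq_sup {a b c : E} (h : oplus a b = some c) (hab : a ⊓ b = ⊥) : c = a ⊔ b := by
  have hle : a ⊔ b ≤ c := sup_le (le_of_oplus h) (le_of_oplus' h)
  obtain ⟨r, hr⟩ := (InducedOrder.le_iff _ _).1 hle
  -- The defect `r = c ⊖ (a ⊔ b)` is at most `c ⊖ a = b` and `c ⊖ b = a`, hence below `a ⊓ b = ⊥`.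
  have key : ∀ x y : E, oplus x y = some c → x ≤ a ⊔ b → r ≤ y := by
    intro x y hxy hx
    obtain ⟨s, hs⟩ := (InducedOrder.le_iff _ _).1 hx
    obtain ⟨f, hf, hf'⟩ := oplus_assoc_left hs hr
    rw [oplus_left_cancel hxy hf']
    exact le_of_oplus' hf
  have hr0 : r = 0 := by
    rw [zero_eq_bot, ← le_bot_iff, ← hab]
    exact le_inf (key b a (by rw [oplus_comm, h]) le_sup_right) (key a b h le_sup_left)
  rw [hr0, oplus_zero] at hr
  exact (Option.some.inj hr).symm

/-- If `x` is disjoint from and orthogonal to `a`, it is orthogonal to every multiple of `a`. -/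
theorem nmul_le_compl {x a : E} (hx : a ≤ compl x) (hxa : x ⊓ a = ⊥) (n : ℕ) :
    ∀ b, nmul n a = some b → b ≤ compl x := by
  induction n with
  | zero =>
    intro b hb
    obtain rfl : 0 = b := Option.some.inj hb
    rw [zero_eq_bot]; exact bot_le
  | succ n ih =>
    intro c hc
    obtain ⟨b, hb, hbc⟩ := exists_of_nmul_succ hc
    obtain ⟨s, hs⟩ := le_compl_iff.1 hx
    have h1 : x ⊔ a ≤ compl b :=
      sup_le (le_compl_comm.1 (ih b hb)) (le_compl_iff.2 ⟨c, hbc⟩)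
    -- Disjointness turns `x ⊔ a` into `x ⊕ a`, so `(x ⊕ a) ⊕ b` exists and reassociates to `x ⊕ (a
    -- ⊕ b)`.
    rw [← oplus_eq_sup hs hxa, le_compl_iff] at h1
    obtain ⟨t, ht⟩ := h1
    rw [oplus_comm] at ht
    obtain ⟨f, hf, hf'⟩ := oplus_assoc_left hs ht
    obtain rfl : c = f := Option.some.inj (by rw [← hbc, ← hf, oplus_comm])
    exact le_compl_iff.2 ⟨t, hf'⟩

/-- An atom orthogonal to and distinct from the atom `a` is below no multiple of `a`. -/
theorem inf_nmul_eq_bot {a c : E} (ha : IsAtom a) (hc : IsAtom c) (hne : c ≠ a)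
    (hac : a ≤ compl c) (n : ℕ) : ∀ b, nmul n a = some b → b ⊓ c = ⊥ := by
  have hca : c ⊓ a = ⊥ := (hc.disjoint_of_ne ha hne).eq_bot
  induction n with
  | zero =>
    intro b hb
    obtain rfl : 0 = b := Option.some.inj hb
    rw [zero_eq_bot, bot_inf_eq]
  | succ n ih =>
    intro d hd
    obtain ⟨b, hb, hbd⟩ := exists_of_nmul_succ hd
    rw [inf_comm]
    refine (hc.not_le_iff_disjoint.1 fun hcd => ?_).eq_bot
    obtain ⟨s, hs⟩ := le_compl_iff.1 (le_compl_comm.1 (nmul_le_compl hac hca n b hb))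
    -- By induction `b ⊕ c = b ⊔ c ≤ b ⊕ a`; cancelling `b` gives `c ≤ a`.
    have hsd : s ≤ d := by
      rw [oplus_eq_sup hs (ih b hb)]
      exact sup_le (le_of_oplus hbd) hcd
    have := (oplus_le_oplus_iff hs hbd).1 hsd
    exact hne ((ha.le_iff_eq hc.1).1 this)

/-- Multiples of two distinct orthogonal atoms are orthogonal. -/
theorem nmul_le_compl_nmul {a c : E} (ha : IsAtom a) (hc : IsAtom c) (hne : c ≠ a)
    (hac : c ≤ compl a) {l k : ℕ} {x y : E} (hx : nmul l a = some x) (hy : nmul k c = some y) :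
    y ≤ compl x := by
  have hac' := le_compl_comm.1 hac
  have hca : c ⊓ a = ⊥ := (hc.disjoint_of_ne ha hne).eq_bot
  exact nmul_le_compl (le_compl_comm.1 (nmul_le_compl hac' hca l x hx))
    (inf_nmul_eq_bot ha hc hne hac' l x hx) k y hy

end Lattice

/-- The existing multiples `l a`, `l ≥ 1`, of atoms. -/
def atomMultiples (E : Type u) [EffectAlgebra E] [PartialOrder E] [OrderBot E] : Set E :=
  {b | ∃ (a : E) (l : ℕ), IsAtom a ∧ 1 ≤ l ∧ nmul l a = some b}

theorem mem_joinsOfMultiples_iff [PartialOrder E] [OrderBot E] {x : E} :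
    x ∈ joinsOfMultiples E ↔
      ∃ (n : ℕ) (b : Fin n → E), 1 ≤ n ∧ (∀ i, b i ∈ atomMultiples E) ∧ IsLUB (range b) x := by
  constructor
  · rintro ⟨n, a, l, b, hn, h, hx⟩
    exact ⟨n, b, hn, fun i => ⟨a i, l i, h i⟩, hx⟩
  · rintro ⟨n, b, hn, h, hx⟩
    choose a l h using h
    exact ⟨n, a, l, b, hn, h, hx⟩

theorem atomMultiples_subset_joinsOfMultiples [PartialOrder E] [OrderBot E] :
    atomMultiples E ⊆ joinsOfMultiples E := fun x hx =>
  mem_joinsOfMultiples_iff.2 ⟨1, fun _ => x, le_rfl, fun _ => hx, by simp⟩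

/-! ### Archimedean property and join density -/

section CompleteLattice

variable [CompleteLattice E] [InducedOrder E]

/-- Complete lattice effect algebras are Archimedean. -/
theorem exists_nmul_eq_none {a : E} (ha : a ≠ 0) : ∃ n, nmul n a = none := by
  by_contra! h
  choose b hb using fun n => Option.ne_none_iff_exists'.1 (h n)
  have hb1 : b 1 = a := Option.some.inj ((hb 1).symm.trans (nmul_one a))
  have hab : a ≤ ⨆ n, b n := hb1 ▸ le_iSup b 1
  obtain ⟨r, hr⟩ := (InducedOrder.le_iff _ _).1 hab
  -- Shifting the index shows that removing `a` from the supremum does not lower it.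
  have hle : ⨆ n, b n ≤ r := by
    refine iSup_le fun n => ?_
    have h1 : oplus a (b n) = some (b (n + 1)) := by
      rw [oplus_comm, ← nmul_succ (hb n), hb]
    exact (oplus_le_oplus_iff h1 hr).1 (le_iSup b (n + 1))
  have heq : r = ⨆ n, b n := le_antisymm (le_of_oplus' hr) hle
  rw [← heq, oplus_comm] at hr
  exact ha (oplus_left_cancel hr (oplus_zero r))

theorem finite_setOf_nmul {a : E} (ha : IsAtom a) : {b | ∃ n, nmul n a = some b}.Finite := by
  obtain ⟨N, hN⟩ := exists_nmul_eq_none (a := a) (by rw [zero_eq_bot]; exact ha.1)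
  refine ((Set.finite_Iio N).image fun n => (nmul n a).getD 0).subset ?_
  rintro b ⟨n, hn⟩
  refine ⟨n, ?_, by simp [hn]⟩
  by_contra h
  simp [nmul_eq_none_of_le hN (not_lt.1 h)] at hn

/-- Every element is the join of the multiples of atoms below it. -/
theorem exists_mem_atomMultiples [IsAtomic E] {x y : E} (h : ¬ x ≤ y) :
    ∃ m ∈ atomMultiples E, m ≤ x ∧ ¬ m ≤ y := by
  by_contra! hM
  obtain ⟨c, hc⟩ := (InducedOrder.le_iff _ _).1 (inf_le_left : x ⊓ y ≤ x)
  have hc0 : c ≠ ⊥ := by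
    rintro rfl
    rw [← zero_eq_bot, oplus_zero] at hc
    exact h (inf_eq_left.1 (Option.some.inj hc))
  obtain ⟨a, ha, hac⟩ := (eq_bot_or_exists_atom_le c).resolve_left hc0
  obtain ⟨d, hd⟩ := (InducedOrder.le_iff _ _).1 hac
  obtain ⟨e, he, he'⟩ := oplus_assoc_right hd hc
  -- Under `hM`, `na ≤ x` gives `na ≤ x ⊓ y`, so `(n+1)a` exists below `(x ⊓ y) ⊕ a ≤ x`. All
  -- multiples of `a` would then exist.
  have key : ∀ n, ∃ b, nmul n a = some b ∧ b ≤ x := by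
    intro n
    induction n with
    | zero => exact ⟨0, rfl, by rw [zero_eq_bot]; exact bot_le⟩
    | succ n ih =>
      obtain ⟨b, hb, hbx⟩ := ih
      have hby : b ≤ y := by
        rcases Nat.eq_zero_or_pos n with rfl | hn
        · obtain rfl : 0 = b := Option.some.inj hb
          rw [zero_eq_bot]; exact bot_le
        · exact hM b ⟨a, n, ha, hn, hb⟩ hbx
      obtain ⟨f, hf⟩ := (InducedOrder.le_iff _ _).1 (le_inf hbx hby)
      rw [oplus_comm] at hf
      obtain ⟨g, hg, hg'⟩ := oplus_assoc_left hf he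
      exact ⟨g, (nmul_succ hb).trans hg, (le_of_oplus' hg').trans (le_of_oplus he')⟩
  obtain ⟨n, hn⟩ := exists_nmul_eq_none (a := a) (by rw [zero_eq_bot]; exact ha.1)
  obtain ⟨b, hb, -⟩ := key n
  simp [hn] at hb

/-- Multiples of distinct orthogonal atoms are orthogonal, so only atoms not orthogonal to `a`, or
`a` itself (which may be orthogonal to itself), contribute; each has finitely many multiples. -/
theorem AlmostOrthogonal.finite_atomMultiples (h : AlmostOrthogonal E) {m : E}
    (hm : m ∈ atomMultiples E) : {w ∈ atomMultiples E | ¬ w ≤ compl m}.Finite := by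
  obtain ⟨a, l, ha, -, hl⟩ := hm
  have hfin : ({b | IsAtom b ∧ ¬ b ≤ compl a} ∪ {a}).Finite := (h a ha).union (finite_singleton a)
  have hat : ∀ b ∈ {b | IsAtom b ∧ ¬ b ≤ compl a} ∪ {a}, IsAtom b := by
    rintro b (hb | rfl)
    exacts [hb.1, ha]
  refine (hfin.biUnion fun b hb => finite_setOf_nmul (hat b hb)).subset ?_
  rintro w ⟨⟨c, k, hc, -, hk⟩, hw⟩
  refine mem_iUnion₂.2 ⟨c, ?_, k, hk⟩
  by_contra hcon
  simp only [mem_union, mem_ofPred_eq, mem_singleton_iff, not_or, not_and, not_not] at hcon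
  exact hw (nmul_le_compl_nmul ha hc hcon.2 (hcon.1 hc) hl hk)

end CompleteLattice

end Order

/-! ### Comparison of the three topologies -/

section FamilyTopology

variable {E : Type u} [EffectAlgebra E]

theorem tendsto_familyTopology_iff [PartialOrder E] [OrderBot E] {α : Type*} {l : Filter α}
    {f : α → E} {x : E} :
    Tendsto f l (@nhds E (familyTopology E) x) ↔
      (∀ u ∈ joinsOfMultiples E, ∀ᶠ i in l, (u ≤ f i ↔ u ≤ x)) ∧
        ∀ v ∈ meetsOfCoMultiples E, ∀ᶠ i in l, (f i ≤ v ↔ x ≤ v) := by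
  have key : ∀ s : Set E, Tendsto (fun i => indicator s (1 : E → ℝ) (f i)) l
      (𝓝 (indicator s 1 x)) ↔ ∀ᶠ i in l, (f i ∈ s ↔ x ∈ s) := by
    intro s
    -- Moves the variation from the point to the set, the form treated by the Mathlib criterion.
    have h : ∀ y, indicator s (1 : E → ℝ) y = indicator {_z : Unit | y ∈ s} (fun _ => 1) () := by
      intro y; by_cases hy : y ∈ s <;> simp [hy]
    simp_rw [h]
    exact tendsto_indicator_const_apply_iff_eventually l (1 : ℝ) ()
  have ht : familyTopology E = ⨅ φ ∈ functionFamily E, TopologicalSpace.induced φ inferInstance := by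
    rw [familyTopology, familyUniformity, UniformSpace.toTopologicalSpace_iInf]
    refine iInf_congr fun φ => ?_
    rw [UniformSpace.toTopologicalSpace_iInf]
    rfl
  rw [ht]
  simp only [nhds_iInf, tendsto_iInf, nhds_induced, tendsto_comap_iff, Function.comp_def]
  constructor
  · intro h
    exact ⟨fun u hu => (key _).1 (h _ (Or.inl ⟨u, hu, rfl⟩)),
      fun v hv => (key _).1 (h _ (Or.inr ⟨v, hv, rfl⟩))⟩
  · rintro ⟨h1, h2⟩ _ (⟨u, hu, rfl⟩ | ⟨v, hv, rfl⟩)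
    · exact (key _).2 (h1 u hu)
    · exact (key _).2 (h2 v hv)

theorem compl_mem_meetsOfCoMultiples [PartialOrder E] [OrderBot E] {m : E}
    (hm : m ∈ atomMultiples E) :
    compl m ∈ meetsOfCoMultiples E := by
  change compl (compl m) ∈ joinsOfMultiples E
  rw [compl_compl]
  exact atomMultiples_subset_joinsOfMultiples hm

variable [CompleteLattice E] [InducedOrder E] [IsAtomic E]

/-- A multiple below `a` is eventually below the net, hence below its liminf; join density gives `a
≤ liminf`, and complements give `limsup ≤ a`. Tail infima and suprema are the bounding nets. -/
theorem oConverges_of_tendsto_familyTopology {ι : Type u} [Preorder ι] [IsDirected ι (· ≤ ·)]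
    [Nonempty ι] {x : ι → E} {a : E} (h : Tendsto x atTop (@nhds E (familyTopology E) a)) :
    OConverges x a := by
  obtain ⟨h1, h2⟩ := tendsto_familyTopology_iff.1 h
  have hlow : a ≤ ⨆ i : ι, ⨅ j : Ici i, x j := by
    by_contra hcon
    obtain ⟨m, hm, hma, hmn⟩ := exists_mem_atomMultiples hcon
    obtain ⟨i, hi⟩ := eventually_atTop.1 (h1 m (atomMultiples_subset_joinsOfMultiples hm))
    exact hmn (le_iSup_of_le i (le_iInf fun j => (hi j.1 j.2).2 hma))
  have hupp : ⨅ i : ι, ⨆ j : Ici i, x j ≤ a := by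
    by_contra hcon
    rw [← compl_le_compl_iff] at hcon
    obtain ⟨m, hm, hma, hmn⟩ := exists_mem_atomMultiples hcon
    obtain ⟨i, hi⟩ := eventually_atTop.1 (h2 _ (compl_mem_meetsOfCoMultiples hm))
    refine hmn (le_compl_comm.1 (iInf_le_of_le i (iSup_le fun j => ?_)))
    exact (hi j.1 j.2).2 (le_compl_comm.1 hma)
  have hle : ⨆ i : ι, ⨅ j : Ici i, x j ≤ ⨅ i : ι, ⨆ j : Ici i, x j := by
    refine iSup_le fun i => le_iInf fun j => ?_
    obtain ⟨k, hik, hjk⟩ := directed_of (· ≤ ·) i j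
    exact (iInf_le (fun l : Ici i => x l) ⟨k, hik⟩).trans
      (le_iSup (fun l : Ici j => x l) ⟨k, hjk⟩)
  refine ⟨fun i => ⨅ j : Ici i, x j, fun i => ⨆ j : Ici i, x j, fun i => ⟨?_, ?_⟩, ?_, ?_, ?_, ?_⟩
  · exact iInf_le (fun l : Ici i => x l) ⟨i, le_rfl⟩
  · exact le_iSup (fun l : Ici i => x l) ⟨i, le_rfl⟩
  · exact fun i j hij => le_iInf fun k => iInf_le (fun l : Ici i => x l) ⟨k, hij.trans k.2⟩
  · rw [le_antisymm hlow (hle.trans hupp)]; exact isLUB_iSup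
  · exact fun i j hij => iSup_le fun k => le_iSup (fun l : Ici i => x l) ⟨k, hij.trans k.2⟩
  · rw [le_antisymm (hlow.trans hle) hupp]; exact isGLB_iInf

/-- A topology is finer than another one if nets in the universe of the space that converge for
the first one converge for the second one. -/
theorem le_of_forall_net {X : Type u} {t s : TopologicalSpace X}
    (h : ∀ (ι : Type u) [Preorder ι] [IsDirected ι (· ≤ ·)] [Nonempty ι] (x : ι → X) (a : X),
      Tendsto x atTop (@nhds X t a) → Tendsto x atTop (@nhds X s a)) : t ≤ s := by
  refine le_of_nhds_le_nhds fun a U hU => ?_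
  by_contra hcon
  have hne : ∀ N : {N : Set X // N ∈ @nhds X t a}, ∃ y ∈ N.1, y ∉ U := fun N => by
    by_contra! hN
    exact hcon (mem_of_superset N.2 hN)
  choose y hy hyU using hne
  -- Indexing by the neighbourhoods themselves keeps the net in universe `u`.
  let ι := {N : Set X // N ∈ @nhds X t a}ᵒᵈ
  have : IsDirected ι (· ≤ ·) := ⟨fun A B =>
    ⟨OrderDual.toDual ⟨A.ofDual.1 ∩ B.ofDual.1, inter_mem A.ofDual.2 B.ofDual.2⟩,
      fun _ h => h.1, fun _ h => h.2⟩⟩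
  have : Nonempty ι := ⟨OrderDual.toDual ⟨univ, univ_mem⟩⟩
  have hlim : Tendsto (fun N : ι => y N.ofDual) atTop (@nhds X t a) := fun N hN =>
    mem_map.2 (mem_atTop_sets.2 ⟨OrderDual.toDual ⟨N, hN⟩, fun M hM => hM (hy M.ofDual)⟩)
  obtain ⟨N, hN⟩ := (((h ι _ a hlim).eventually hU).exists)
  exact hyU _ hN

/-- An interval visited frequently contains the limit: its endpoints compare with every term of the
monotone bounding nets. -/
theorem oConvergenceImplies_intervalTopology (L : Type u) [PartialOrder L] :
    OConvergenceImplies L (intervalTopology L) := by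
  rintro ι _ _ _ x a ⟨v, w, hvw, hv, hva, hw, hwa⟩
  rw [TopologicalSpace.tendsto_nhds_generateFrom_iff]
  rintro _ ⟨c, d, -, rfl⟩ ha
  by_contra hcon
  refine ha ⟨?_, ?_⟩
  · refine (le_isGLB_iff hwa).2 ?_
    rintro _ ⟨i, rfl⟩
    have hfreq : ∃ᶠ j in atTop, x j ∈ Icc c d := fun h => hcon h
    obtain ⟨j, hj, hij⟩ := (hfreq.and_eventually (eventually_ge_atTop i)).exists
    exact hj.1.trans ((hvw j).2.trans (hw hij))
  · refine (isLUB_le_iff hva).2 ?_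
    rintro _ ⟨i, rfl⟩
    have hfreq : ∃ᶠ j in atTop, x j ∈ Icc c d := fun h => hcon h
    obtain ⟨j, hj, hij⟩ := (hfreq.and_eventually (eventually_ge_atTop i)).exists
    exact ((hv hij).trans (hvw j).1).trans hj.2

theorem isClosed_Icc_intervalTopology {L : Type u} [PartialOrder L] {a b : L} (h : a ≤ b) :
    IsClosed[intervalTopology L] (Icc a b) :=
  (@isOpen_compl_iff _ _ (intervalTopology L)).1
    (TopologicalSpace.isOpen_generateFrom_of_mem ⟨a, b, h, rfl⟩)

theorem AlmostOrthogonal.eventually_le_iff (h : AlmostOrthogonal E) {m : E}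
    (hm : m ∈ atomMultiples E) (x : E) :
    ∀ᶠ y in @nhds E (intervalTopology E) x, (m ≤ y ↔ m ≤ x) := by
  let t := intervalTopology E
  by_cases hx : m ≤ x
  -- This finite union of intervals is exactly `{y | ¬ m ≤ y}`, by join density applied to `compl
  -- y`.
  · have hcl : IsClosed (⋃ w ∈ {w ∈ atomMultiples E | ¬ w ≤ compl m}, Icc ⊥ (compl w)) :=
      (h.finite_atomMultiples hm).isClosed_biUnion
        fun w _ => isClosed_Icc_intervalTopology bot_le
    have hxU : x ∈ (⋃ w ∈ {w ∈ atomMultiples E | ¬ w ≤ compl m}, Icc ⊥ (compl w))ᶜ := by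
      simp only [mem_compl_iff, mem_iUnion₂, not_exists]
      exact fun w hw hxw => hw.2 (le_compl_comm.1 (hx.trans hxw.2))
    filter_upwards [hcl.isOpen_compl.mem_nhds hxU] with y hy
    refine iff_of_true ?_ hx
    by_contra hmy
    rw [← compl_le_compl_iff] at hmy
    obtain ⟨w, hw, hwy, hwm⟩ := exists_mem_atomMultiples hmy
    exact hy (mem_iUnion₂.2 ⟨w, ⟨hw, hwm⟩, bot_le, le_compl_comm.1 hwy⟩)
  · have hcl : IsClosed (Icc m ⊤) := isClosed_Icc_intervalTopology le_top
    filter_upwards [hcl.isOpen_compl.mem_nhds (x := x) fun h => hx h.1] with y hy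
    exact iff_of_false (fun h => hy ⟨h, le_top⟩) hx

theorem AlmostOrthogonal.eventually_le_compl_iff (h : AlmostOrthogonal E) {m : E}
    (hm : m ∈ atomMultiples E) (x : E) :
    ∀ᶠ y in @nhds E (intervalTopology E) x, (m ≤ compl y ↔ m ≤ compl x) := by
  let t := intervalTopology E
  by_cases hx : m ≤ compl x
  · have hcl : IsClosed (⋃ w ∈ {w ∈ atomMultiples E | ¬ w ≤ compl m}, Icc w ⊤) :=
      (h.finite_atomMultiples hm).isClosed_biUnion
        fun w _ => isClosed_Icc_intervalTopology le_top
    have hxU : x ∈ (⋃ w ∈ {w ∈ atomMultiples E | ¬ w ≤ compl m}, Icc w ⊤)ᶜ := by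
      simp only [mem_compl_iff, mem_iUnion₂, not_exists]
      exact fun w hw hxw => hw.2 (hxw.1.trans (le_compl_comm.1 hx))
    filter_upwards [hcl.isOpen_compl.mem_nhds hxU] with y hy
    refine iff_of_true ?_ hx
    by_contra hmy
    rw [le_compl_comm] at hmy
    obtain ⟨w, hw, hwy, hwm⟩ := exists_mem_atomMultiples hmy
    exact hy (mem_iUnion₂.2 ⟨w, ⟨hw, hwm⟩, hwy, le_top⟩)
  · have hcl : IsClosed (Icc ⊥ (compl m)) := isClosed_Icc_intervalTopology bot_le
    filter_upwards [hcl.isOpen_compl.mem_nhds (x := x) fun h => hx (le_compl_comm.1 h.2)] with y hy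
    exact iff_of_false (fun h => hy ⟨bot_le, le_compl_comm.1 h⟩) hx

theorem AlmostOrthogonal.intervalTopology_le (h : AlmostOrthogonal E) :
    intervalTopology E ≤ familyTopology E := by
  refine le_of_nhds_le_nhds fun x => ?_
  refine tendsto_id'.1 (tendsto_familyTopology_iff.2 ⟨fun u hu => ?_, fun v hv => ?_⟩)
  · obtain ⟨n, b, -, hb, hub⟩ := mem_joinsOfMultiples_iff.1 hu
    filter_upwards [eventually_all.2 fun i => h.eventually_le_iff (hb i) x] with y hy
    simp only [id, isLUB_le_iff hub, mem_upperBounds, forall_mem_range, hy]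
  · obtain ⟨n, b, -, hb, hub⟩ := mem_joinsOfMultiples_iff.1 hv
    filter_upwards [eventually_all.2 fun i => h.eventually_le_compl_iff (hb i) x] with y hy
    rw [id, ← compl_le_compl_iff, ← compl_le_compl_iff (a := x)]
    simp only [isLUB_le_iff hub, mem_upperBounds, forall_mem_range, hy]

variable (E) in
theorem familyTopology_le_oTopology : familyTopology E ≤ oTopology E :=
  le_of_forall_net fun ι _ _ _ x a h =>
    (isLeast_oTopology E).1 ι x a (oConverges_of_tendsto_familyTopology h)

variable (E) in
theorem t2Space_familyTopology : @T2Space E (familyTopology E) := by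
  let t := familyTopology E
  have key : ∀ x y : E, ¬ x ≤ y → Disjoint (𝓝 x) (𝓝 y) := by
    intro x y hxy
    obtain ⟨m, hm, hmx, hmy⟩ := exists_mem_atomMultiples hxy
    have h : ∀ z : E, ∀ᶠ w in 𝓝 z, (m ≤ w ↔ m ≤ z) := fun z =>
      (tendsto_familyTopology_iff.1 (tendsto_id (x := 𝓝 z))).1 m
        (atomMultiples_subset_joinsOfMultiples hm)
    refine disjoint_iff.2 (eventually_false_iff_eq_bot.1 ?_)
    filter_upwards [(h x).filter_mono inf_le_left, (h y).filter_mono inf_le_right] with w h1 h2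
    exact hmy (h2.1 (h1.2 hmx))
  refine t2Space_iff_disjoint_nhds.2 fun x y hxy => ?_
  by_cases h : x ≤ y
  · exact (key y x fun h' => hxy (le_antisymm h h')).symm
  · exact key x y h

theorem oContinuous_of_oTopology_eq (h : oTopology E = familyTopology E) : OContinuous E := by
  intro ι _ _ _ x a y hx ha
  refine ⟨?_, fun b hb => ?_⟩
  · rintro _ ⟨i, rfl⟩
    exact inf_le_inf_right y (ha.1 ⟨i, rfl⟩)
  · by_contra hcon
    obtain ⟨m, hm, hma, hmb⟩ := exists_mem_atomMultiples hcon
    have hlim : Tendsto x atTop (@nhds E (familyTopology E) a) := by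
      rw [← h]
      refine (isLeast_oTopology E).1 ι x a ⟨x, fun _ => a, fun i => ⟨le_rfl, ha.1 ⟨i, rfl⟩⟩, hx,
        ha, antitone_const, ?_⟩
      rw [range_const]
      exact isGLB_singleton
    obtain ⟨i, hi⟩ := ((tendsto_familyTopology_iff.1 hlim).1 m
      (atomMultiples_subset_joinsOfMultiples hm)).exists
    exact hmb ((le_inf (hi.2 (hma.trans inf_le_left)) (hma.trans inf_le_right)).trans
      (hb ⟨i, rfl⟩))

end FamilyTopology

/-! ### From (o)-continuity and Hausdorffness to almost orthogonality -/

/-- An interval in `F` contains two distinct atoms, so it starts at `⊥`, and its upper end dominates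
the limsup. Thus `F` converges to every point below its limsup, and limits are unique. -/
theorem limsup_eq_bot_of_t2Space {L : Type u} [CompleteLattice L]
    (hT : @T2Space L (intervalTopology L)) (F : Ultrafilter L) (hF : (F : Filter L) ≤ cofinite)
    (hat : ∀ᶠ b in (F : Filter L), IsAtom b) : ⨅ A : {A : Set L // A ∈ F}, sSup A.1 = ⊥ := by
  have hbot : ∀ c d : L, Icc c d ∈ F → c = ⊥ := by
    intro c d h
    have hinf : (Icc c d ∩ {b | IsAtom b}).Infinite := fun hfin => by
      have h1 := hF hfin.compl_mem_cofinite
      exact F.compl_notMem_iff.2 (inter_mem h hat) h1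
    obtain ⟨b, hb⟩ := hinf.nonempty
    obtain ⟨b', hb', hne⟩ := hinf.exists_notMem_finite (finite_singleton b)
    exact le_bot_iff.1 ((hb.2.disjoint_of_ne hb'.2 fun h => hne h.symm) hb.1.1 hb'.1.1)
  have key : ∀ x : L, x ≤ ⨅ A : {A : Set L // A ∈ F}, sSup A.1 →
      (F : Filter L) ≤ @nhds L (intervalTopology L) x := by
    intro x hx
    refine tendsto_id'.1 (TopologicalSpace.tendsto_nhds_generateFrom_iff.2 ?_)
    rintro _ ⟨c, d, -, rfl⟩ hxcd
    by_contra hcon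
    have hcd : Icc c d ∈ F := F.compl_notMem_iff.1 hcon
    refine hxcd ⟨by rw [hbot c d hcd]; exact bot_le, hx.trans ?_⟩
    exact (iInf_le _ (⟨_, hcd⟩ : {A : Set L // A ∈ F})).trans (sSup_le fun b hb => hb.2)
  exact @tendsto_nhds_unique L L (intervalTopology L) hT id F _ _ F.neBot (key _ le_rfl)
    (key ⊥ bot_le)

theorem almostOrthogonal_of_oContinuous {E : Type u} [EffectAlgebra E] [CompleteLattice E]
    [InducedOrder E] (hc : OContinuous E) (hT : @T2Space E (intervalTopology E)) :
    AlmostOrthogonal E := by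
  intro a ha
  by_contra hinf
  let S : Set E := {b | IsAtom b ∧ ¬ b ≤ compl a}
  have : NeBot (cofinite ⊓ 𝓟 S) := Set.Infinite.cofinite_inf_principal_neBot hinf
  let F := Ultrafilter.of (cofinite ⊓ 𝓟 S)
  have hF : (F : Filter E) ≤ cofinite ⊓ 𝓟 S := Ultrafilter.of_le _
  have hS : S ∈ F := hF.trans inf_le_right (mem_principal_self S)
  have hlim := limsup_eq_bot_of_t2Space hT F (hF.trans inf_le_left)
    (mem_of_superset hS fun b hb => hb.1)
  let ι := {A : Set E // A ∈ F}ᵒᵈ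
  have : IsDirected ι (· ≤ ·) := ⟨fun A B =>
    ⟨OrderDual.toDual ⟨A.ofDual.1 ∩ B.ofDual.1, inter_mem A.ofDual.2 B.ofDual.2⟩,
      fun _ h => h.1, fun _ h => h.2⟩⟩
  have : Nonempty ι := ⟨OrderDual.toDual ⟨univ, univ_mem⟩⟩
  let x : ι → E := fun A => compl (sSup A.ofDual.1)
  have hx : Monotone x := fun A B hAB => compl_le_compl (sSup_le_sSup hAB)
  have hlub : IsLUB (range x) ⊤ := by
    refine ⟨fun _ _ => le_top, fun b hb => ?_⟩
    rw [← compl_bot, ← hlim, ← compl_compl b]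
    refine compl_le_compl (le_iInf fun A => ?_)
    have h := compl_le_compl (hb ⟨OrderDual.toDual A, rfl⟩)
    rwa [compl_compl] at h
  have h := hc ι x ⊤ a hx hlub
  rw [top_inf_eq] at h
  -- If every `x A ⊓ a` were `⊥`, so would be their supremum `a`. But `a ≤ x A` would make every
  -- atom in `A` orthogonal to `a`, while `A` meets `S`.
  refine ha.1 (le_bot_iff.1 ((isLUB_le_iff h).2 ?_))
  rintro _ ⟨A, rfl⟩
  change x A ⊓ a ≤ ⊥
  rw [inf_comm]
  refine (ha.not_le_iff_disjoint.1 fun hA => ?_).le_bot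
  obtain ⟨b, hb, hbS⟩ := F.nonempty_of_mem (inter_mem A.ofDual.2 hS)
  exact hbS.2 (le_compl_comm.1 (hA.trans (compl_le_compl (le_sSup hb))))

end EffectAlgebra

theorem mainTheorem12 {E : Type u} [EffectAlgebra E] [CompleteLattice E]
    [EffectAlgebra.InducedOrder E] [IsAtomic E] :
    List.TFAE [
      EffectAlgebra.AlmostOrthogonal E,
      intervalTopology E = oTopology E ∧ oTopology E = EffectAlgebra.familyTopology E ∧
        TopologicalOConvergence E (oTopology E),
      OContinuous E ∧ @T2Space E (intervalTopology E)] := by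
  tfae_have 1 → 2 := by
    intro h
    have h1 : oTopology E ≤ intervalTopology E :=
      sInf_le (EffectAlgebra.oConvergenceImplies_intervalTopology E)
    have h2 := h.intervalTopology_le
    have h3 := EffectAlgebra.familyTopology_le_oTopology E
    have h4 : oTopology E = EffectAlgebra.familyTopology E := le_antisymm (h1.trans h2) h3
    refine ⟨le_antisymm (h2.trans h3) h1, h4, fun ι _ _ _ x a => ⟨fun hx => ?_, ?_⟩⟩
    · rw [h4] at hx
      exact EffectAlgebra.oConverges_of_tendsto_familyTopology hx
    · exact (isLeast_oTopology E).1 ι x a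
  tfae_have 2 → 3 := by
    rintro ⟨h1, h2, -⟩
    refine ⟨EffectAlgebra.oContinuous_of_oTopology_eq h2, ?_⟩
    rw [h1, h2]
    exact EffectAlgebra.t2Space_familyTopology E
  tfae_have 3 → 1 := fun h => EffectAlgebra.almostOrthogonal_of_oContinuous h.1 h.2
  tfae_finish
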